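/- Let $\mu\in\mathbb R$, $\sigma>0$, let $X_1,X_2,\ldots$ be i.i.d. random variables with law $N(\mu,\sigma^2)$ on a probability space, and put $K_m=\sum_{j=1}^m X_j$. Let $L\ge 1$ and $0<k_1<k_2<\cdots<k_{L+1}$ be integers, let $\psi:\mathbb R\to[0,1]$ be Borel measurable, and let $\gamma\ge 0$. For each integer $n\ge 1$ let $N_n$ be a random variable with values in $\{k_1n,\ldots,k_{L+1}n\}$ such that, for each $i\in\{1,\ldots,L\}$, the event $\{N_n=k_in\}$ does not depend on the observations after the $k_in$-th, in the sense that almost surely $$\mathbb P[N_n=k_in\mid X_1,X_2,\ldots]=\mathbb P[N_n=k_in\mid X_1,\ldots,X_{k_in}],$$ and the stopping rule $$\mathbb P[N_n=k_in\mid X_1,\ldots,X_{k_in}]=\psi\!\left(\frac{K_{k_in}}{(k_in)^\gamma}\right)\prod_{j=1}^{i-1}\left(1-\psi\!\left(\frac{K_{k_jn}}{(k_jn)^\gamma}\right)\right)$$ holds almost surely (the empty product is $1$). Let $\widehat\mu_{N_n}=K_{N_n}/N_n$, let $\xi$ be a standard normal random variable, and let $d_{TV}(Y,Z)=\sup_A|\mathbb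 P[Y\in A]-\mathbb P[Z\in A]|$, the supremum running over all Borel sets $A\subset\mathbb R$. Then $$d_{TV}\!\left(\xi,\frac{\sqrt{N_n}}{\sigma}\left(\widehat\mu_{N_n}-\mu\right)\right)\to 0\quad\text{as } n\to\infty$$ in each of the following cases (where the limit of $\psi$ in a point $a$ is taken over arguments $x\to a$, $x\ne a$): (A) $\gamma>1$ and $\psi$ has a finite limit in $0$; (B) $\gamma=1$ and $\psi$ has a finite limit in $\mu$; (C) (1) $1/2<\gamma<1$, $\mu\ne 0$, and $\psi$ has finite limits in $-\infty$ and $\infty$; (2) $1/2<\gamma<1$, $\mu=0$, and $\psi$ has a finite limit in $0$; (D) $\gamma=1/2$, $\mu\ne0$, and $\psi$ has finite limits in $-\infty$ and $\infty$; (E) (1) $0\le\gamma<1/2$, $\mu\ne 0$, and $\psi$ has finite limits in $-\infty$ and $\infty$; (2) $0\le\gamma<1/2$, $\mu=0$, and $\psi$ has coinciding finite limits in $-\infty$ and $\infty$. In particular, with $\Phi$ the standard normal cumulative distribution function, in each of these cases and for each $x>0$, $$\left|2\Phi(x)-1-\mathbb P\!\left[\widehat\mu_{N_n}-\frac{\sigma}{\sqrt{N_n}}x\le\mu\le\widehat\mu_{N_n}+\frac{\sigma}{\sqrt{N_n}}x\right]\right|\to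 0\quad\text{as } n\to\infty.$$ -/

import Mathlib

open MeasureTheory ProbabilityTheory Filter Topology

noncomputable section

/-- The sum `K_m` of the first `m` observations. The `j`-th observation of the mathematical text
(`j = 1, 2, …`) is `X (j - 1)`. -/
def partialSum {Ω : Type*} (X : ℕ → Ω → ℝ) (m : ℕ) (ω : Ω) : ℝ :=
  ∑ j ∈ Finset.range m, X j ω

/-- The σ-algebra generated by the first `m` observations. -/
abbrev sigmaFirst {Ω : Type*} (X : ℕ → Ω → ℝ) (m : ℕ) : MeasurableSpace Ω :=
  MeasurableSpace.comap (fun ω (j : Fin m) => X j ω) inferInstance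

/-- The σ-algebra generated by all observations. -/
abbrev sigmaAll {Ω : Type*} (X : ℕ → Ω → ℝ) : MeasurableSpace Ω :=
  MeasurableSpace.comap (fun ω (j : ℕ) => X j ω) inferInstance

/-- The conditional probability of the event `A` given the σ-algebra `m`. -/
def condProbEvent {Ω : Type*} [MeasurableSpace Ω] (P : Measure Ω) (A : Set Ω)
    (m : MeasurableSpace Ω) : Ω → ℝ :=
  P[A.indicator (fun _ => (1 : ℝ)) | m]

/-- `N` is a random sample size of a group sequential trial with observations `X`, possible sample
sizes `k 0 * n < … < k L * n` (interim analyses at all but the last of them), shape parameter `γ`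
and stopping rule given by `ψ`. -/
structure IsGroupSequentialSize {Ω : Type*} [MeasurableSpace Ω] (P : Measure Ω)
    (X : ℕ → Ω → ℝ) (ψ : ℝ → ℝ) (γ : ℝ) {L : ℕ} (k : Fin (L + 1) → ℕ) (n : ℕ)
    (N : Ω → ℕ) : Prop where
  measurable : Measurable N
  /-- The possible values of the sample size. -/
  mem_range : ∀ ω, ∃ i, N ω = k i * n
  /-- The decision to stop at an interim analysis does not depend on the later observations:
  its conditional probability given all observations is the one given the observations that are
  available at that analysis. -/
  nonanticipating : ∀ i : Fin L,
    condProbEvent P {ω | N ω = k i.castSucc * n} (sigmaAll X) =ᵐ[P]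
      condProbEvent P {ω | N ω = k i.castSucc * n} (sigmaFirst X (k i.castSucc * n))
  /-- The stopping rule. -/
  stopping_rule : ∀ i : Fin L,
    condProbEvent P {ω | N ω = k i.castSucc * n} (sigmaFirst X (k i.castSucc * n)) =ᵐ[P]
      fun ω =>
        ψ (partialSum X (k i.castSucc * n) ω / ((k i.castSucc : ℝ) * n) ^ γ) *
          ∏ j ∈ Finset.Iio i.castSucc,
            (1 - ψ (partialSum X (k j * n) ω / ((k j : ℝ) * n) ^ γ))

/-- The sample mean `K_N / N` at the random sample size `N`. -/
def sampleMean {Ω : Type*} (X : ℕ → Ω → ℝ) (N : Ω → ℕ) (ω : Ω) : ℝ :=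
  partialSum X (N ω) ω / N ω

/-- The total variation distance between the real random variables `Y` and `Z`: the supremum of
`|P[Y ∈ A] - Q[Z ∈ A]|` over all Borel sets `A`. -/
def tvDist {Ω Ω' : Type*} [MeasurableSpace Ω] [MeasurableSpace Ω'] (P : Measure Ω) (Y : Ω → ℝ)
    (Q : Measure Ω') (Z : Ω' → ℝ) : ℝ :=
  ⨆ A : {A : Set ℝ // MeasurableSet A}, |P.real (Y ⁻¹' A.1) - Q.real (Z ⁻¹' A.1)|

end

open scoped NNReal

/-! ### Gaussian partial sums -/

/-! Given all observations, the trial stops at stage `i` with probability `stopWeight (stageProb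
...) i`. Were these weights constants summing to one, the studentised mean would be exactly standard
normal, as a mixture of standardised sums at fixed sizes. Hence, for every Borel set, the error is
at most the sum of the mean distances of the weights from constants
(`abs_measureReal_preimage_sub_le`), a bound independent of the set.

Weights are products of bounded factors, so convergence in mean reduces to a single factor `ψ (K_m /
m ^ γ)`. Its mean distance from `l` involves only the law of `K_m`, so the standardised sum may be
replaced by one normal variable `x` that does not vary with `m`. Then `K_m / m ^ γ` becomes the
explicit sequence `scaledSum μ σ γ x m`; its limit for almost every fixed `x` and dominated
convergence suffice (`tendsto_integral_abs_comp_partialSum_sub`). The cases differ only in where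
this sequence goes. -/

lemma measurable_partialSum {Ω : Type*} [MeasurableSpace Ω] {X : ℕ → Ω → ℝ}
    (hX : ∀ j, Measurable (X j)) (m : ℕ) : Measurable (partialSum X m) := by
  unfold partialSum
  fun_prop

lemma measurable_sigmaAll_partialSum {Ω : Type*} (X : ℕ → Ω → ℝ) (m : ℕ) :
    Measurable[sigmaAll X] (partialSum X m) := by
  have h : partialSum X m =
      (fun f : ℕ → ℝ => ∑ j ∈ Finset.range m, f j) ∘ fun ω (j : ℕ) => X j ω := rfl
  rw [h]
  exact (by fun_prop : Measurable fun f : ℕ → ℝ => ∑ j ∈ Finset.range m, f j).comp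
    (comap_measurable _)

lemma map_partialSum {Ω : Type*} [MeasurableSpace Ω] {P : Measure Ω} [IsProbabilityMeasure P]
    {μ : ℝ} {v : ℝ≥0} {X : ℕ → Ω → ℝ} (hX : ∀ j, Measurable (X j)) (hindep : iIndepFun X P)
    (hlaw : ∀ j, P.map (X j) = gaussianReal μ v) (m : ℕ) :
    P.map (partialSum X m) = gaussianReal (m * μ) (m * v) := by
  induction m with
  | zero =>
    have h : partialSum X 0 = fun _ => (0 : ℝ) := by
      ext ω
      simp [partialSum]
    simp [h, Measure.map_const]
  | succ m ih =>
    have hS : partialSum X m = ∑ j ∈ Finset.range m, X j := by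
      ext ω
      simp [partialSum]
    have h : partialSum X (m + 1) = partialSum X m + X m := by
      ext ω
      simp [partialSum, Finset.sum_range_succ]
    have hi : IndepFun (partialSum X m) (X m) P := hS ▸ hindep.indepFun_sum_range_succ hX m
    rw [h, gaussianReal_add_gaussianReal_of_indepFun hi ih (hlaw m)]
    push_cast
    congr 1 <;> ring

/-- The standardised partial sum `(K_m - m μ) / (σ √m)`. -/
noncomputable def standardizedSum {Ω : Type*} (X : ℕ → Ω → ℝ) (μ σ : ℝ) (m : ℕ) (ω : Ω) : ℝ :=
  (partialSum X m ω - m * μ) / (σ * √m)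

lemma map_standardizedSum {Ω : Type*} [MeasurableSpace Ω] {P : Measure Ω}
    [IsProbabilityMeasure P] {μ σ : ℝ} (hσ : 0 < σ) {X : ℕ → Ω → ℝ}
    (hX : ∀ j, Measurable (X j)) (hindep : iIndepFun X P)
    (hlaw : ∀ j, P.map (X j) = gaussianReal μ ⟨σ ^ 2, sq_nonneg σ⟩) {m : ℕ} (hm : 0 < m) :
    P.map (standardizedSum X μ σ m) = gaussianReal 0 1 := by
  obtain ⟨v, hv, hvσ⟩ : ∃ v : ℝ≥0, (∀ j, P.map (X j) = gaussianReal μ v) ∧ (v : ℝ) = σ ^ 2 :=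
    ⟨_, hlaw, rfl⟩
  have h : standardizedSum X μ σ m =
      (fun x : ℝ => x / (σ * √m)) ∘ (fun x : ℝ => x - m * μ) ∘ partialSum X m := rfl
  have hm' : (0 : ℝ) < m := by exact_mod_cast hm
  rw [h, ← Measure.map_map (by fun_prop) ((by fun_prop : Measurable fun x : ℝ => x - m * μ).comp
      (measurable_partialSum hX m)), ← Measure.map_map (by fun_prop) (measurable_partialSum hX m),
    map_partialSum hX hindep hv, gaussianReal_map_sub_const, gaussianReal_map_div_const]
  congr 1
  · simp
  · ext
    have := Real.sq_sqrt hm'.le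
    simp only [NNReal.coe_div, NNReal.coe_mul, NNReal.coe_natCast, NNReal.coe_mk, NNReal.coe_one,
      mul_pow, this, hvσ]
    field_simp

lemma partialSum_eq {Ω : Type*} {X : ℕ → Ω → ℝ} {μ σ : ℝ} (hσ : 0 < σ) {m : ℕ} (hm : 0 < m)
    (ω : Ω) : partialSum X m ω = m * μ + σ * √m * standardizedSum X μ σ m ω := by
  have hm' : (0 : ℝ) < √m := by positivity
  rw [standardizedSum]
  field_simp
  ring

lemma sqrt_div_mul_sampleMean_sub {Ω : Type*} {X : ℕ → Ω → ℝ} {μ σ : ℝ} (hσ : 0 < σ)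
    {N : Ω → ℕ} {ω : Ω} (hN : 0 < N ω) :
    √(N ω : ℝ) / σ * (sampleMean X N ω - μ) = standardizedSum X μ σ (N ω) ω := by
  have h1 : (0 : ℝ) < N ω := by exact_mod_cast hN
  have h2 : (0 : ℝ) < √(N ω : ℝ) := by positivity
  have h3 : √(N ω : ℝ) ^ 2 = N ω := Real.sq_sqrt h1.le
  rw [standardizedSum, sampleMean]
  field_simp
  rw [h3]

/-! ### Convergence in mean of products of bounded functions -/

/-- Split `f g - c d = (f - c) g + c (g - d)` and use `|g| ≤ 1`. No independence of the factors is
needed. -/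
lemma tendsto_integral_abs_mul_sub {Ω : Type*} [MeasurableSpace Ω] {P : Measure Ω}
    [IsProbabilityMeasure P] {f g : ℕ → Ω → ℝ} {c d : ℝ}
    (hf : ∀ n, Measurable (f n)) (hg : ∀ n, Measurable (g n))
    (hf1 : ∀ n ω, |f n ω| ≤ 1) (hg1 : ∀ n ω, |g n ω| ≤ 1)
    (hfc : Tendsto (fun n => ∫ ω, |f n ω - c| ∂P) atTop (𝓝 0))
    (hgd : Tendsto (fun n => ∫ ω, |g n ω - d| ∂P) atTop (𝓝 0)) :
    Tendsto (fun n => ∫ ω, |f n ω * g n ω - c * d| ∂P) atTop (𝓝 0) := by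
  have hlim : Tendsto (fun n => (∫ ω, |f n ω - c| ∂P) + |c| * ∫ ω, |g n ω - d| ∂P)
      atTop (𝓝 0) := by
    simpa using hfc.add (hgd.const_mul |c|)
  refine squeeze_zero (fun n => integral_nonneg fun ω => abs_nonneg _) (fun n => ?_) hlim
  have hif : Integrable (f n) P :=
    Integrable.of_bound (hf n).aestronglyMeasurable 1 (ae_of_all _ (hf1 n))
  have hig : Integrable (g n) P :=
    Integrable.of_bound (hg n).aestronglyMeasurable 1 (ae_of_all _ (hg1 n))
  have h1 : Integrable (fun ω => |f n ω - c|) P := (hif.sub (integrable_const c)).abs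
  have h2 : Integrable (fun ω => |c| * |g n ω - d|) P :=
    (hig.sub (integrable_const d)).abs.const_mul _
  rw [← integral_const_mul, ← integral_add h1 h2]
  refine integral_mono_of_nonneg (ae_of_all _ fun ω => abs_nonneg _) (h1.add h2)
    (ae_of_all _ fun ω => ?_)
  calc |f n ω * g n ω - c * d| = |(f n ω - c) * g n ω + c * (g n ω - d)| := by ring_nf
    _ ≤ |(f n ω - c) * g n ω| + |c * (g n ω - d)| := abs_add_le _ _
    _ ≤ |f n ω - c| + |c| * |g n ω - d| := by
      rw [abs_mul, abs_mul]
      gcongr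
      exact mul_le_of_le_one_right (abs_nonneg _) (hg1 n ω)

lemma tendsto_integral_abs_prod_sub {Ω ι : Type*} [MeasurableSpace Ω] {P : Measure Ω}
    [IsProbabilityMeasure P] (s : Finset ι) {f : ι → ℕ → Ω → ℝ} {c : ι → ℝ}
    (hf : ∀ i n, Measurable (f i n)) (hf1 : ∀ i n ω, |f i n ω| ≤ 1)
    (hfc : ∀ i, Tendsto (fun n => ∫ ω, |f i n ω - c i| ∂P) atTop (𝓝 0)) :
    Tendsto (fun n => ∫ ω, |∏ i ∈ s, f i n ω - ∏ i ∈ s, c i| ∂P) atTop (𝓝 0) := by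
  classical
  induction s using Finset.induction_on with
  | empty => simp
  | insert a s ha ih =>
    simp only [Finset.prod_insert ha]
    refine tendsto_integral_abs_mul_sub (hf a) (fun n => ?_) (hf1 a) (fun n ω => ?_) (hfc a) ih
    · exact Finset.measurable_fun_prod s fun i _ => hf i n
    · rw [Finset.abs_prod]
      exact Finset.prod_le_one (fun i _ => abs_nonneg _) fun i _ => hf1 i n ω

/-! ### Stopping weights -/

/-- The probability of stopping at stage `i` when `r j` is the conditional probability of stopping
at stage `j` once it is reached. -/
def stopWeight {L : ℕ} (r : Fin (L + 1) → ℝ) (i : Fin (L + 1)) : ℝ :=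
  r i * ∏ j ∈ Finset.Iio i, (1 - r j)

/-- The sum telescopes to `1 - ∏ (1 - r j)`, and the last factor of the product vanishes. -/
lemma sum_stopWeight {L : ℕ} {r : Fin (L + 1) → ℝ} (hr : r (Fin.last L) = 1) :
    ∑ i, stopWeight r i = 1 := by
  have h := Finset.prod_one_sub_ordered Finset.univ r
  rw [Finset.prod_eq_zero (Finset.mem_univ (Fin.last L)) (by rw [hr, sub_self])] at h
  have h' : ∑ i, stopWeight r i = ∑ i, r i * ∏ j ∈ Finset.univ with j < i, (1 - r j) :=
    Finset.sum_congr rfl fun i _ => by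
      rw [stopWeight]
      congr 2
      ext j
      simp
  linarith

lemma measurable_stopWeight {Ω : Type*} [MeasurableSpace Ω] {L : ℕ} {r : Fin (L + 1) → Ω → ℝ}
    (hr : ∀ i, Measurable (r i)) (i : Fin (L + 1)) :
    Measurable fun ω => stopWeight (fun j => r j ω) i :=
  (hr i).mul (Finset.measurable_fun_prod _ fun j _ => measurable_const.sub (hr j))

lemma abs_stopWeight_le_one {L : ℕ} {r : Fin (L + 1) → ℝ} (hr : ∀ i, r i ∈ Set.Icc (0 : ℝ) 1)
    (i : Fin (L + 1)) : |stopWeight r i| ≤ 1 := by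
  rw [stopWeight, abs_mul, Finset.abs_prod]
  refine mul_le_one₀ ?_ (Finset.prod_nonneg fun _ _ => abs_nonneg _)
    (Finset.prod_le_one (fun _ _ => abs_nonneg _) fun j _ => ?_)
  · exact abs_le.2 ⟨by linarith [(hr i).1], (hr i).2⟩
  · exact abs_le.2 ⟨by linarith [(hr j).2], by linarith [(hr j).1]⟩

lemma tendsto_integral_abs_stopWeight_sub {Ω : Type*} [MeasurableSpace Ω] {P : Measure Ω}
    [IsProbabilityMeasure P] {L : ℕ} {r : Fin (L + 1) → ℕ → Ω → ℝ} {c : Fin (L + 1) → ℝ}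
    (hr : ∀ i n, Measurable (r i n)) (hr1 : ∀ i n ω, r i n ω ∈ Set.Icc (0 : ℝ) 1)
    (hrc : ∀ i, Tendsto (fun n => ∫ ω, |r i n ω - c i| ∂P) atTop (𝓝 0)) (i : Fin (L + 1)) :
    Tendsto (fun n => ∫ ω, |stopWeight (fun j => r j n ω) i - stopWeight c i| ∂P)
      atTop (𝓝 0) := by
  have h1 : ∀ i n ω, |1 - r i n ω| ≤ 1 := fun i n ω =>
    abs_le.2 ⟨by linarith [(hr1 i n ω).2], by linarith [(hr1 i n ω).1]⟩
  refine tendsto_integral_abs_mul_sub (hr i)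
    (fun n => Finset.measurable_fun_prod _ fun j _ => measurable_const.sub (hr j n))
    (fun n ω => abs_le.2 ⟨by linarith [(hr1 i n ω).1], (hr1 i n ω).2⟩)
    (fun n ω => ?_) (hrc i)
    (tendsto_integral_abs_prod_sub _ (fun j n => measurable_const.sub (hr j n)) h1 fun j => ?_)
  · rw [Finset.abs_prod]
    exact Finset.prod_le_one (fun _ _ => abs_nonneg _) fun j _ => h1 j n ω
  · refine (hrc j).congr fun n => integral_congr_ae (ae_of_all _ fun ω => ?_)
    dsimp only
    rw [← abs_neg]
    ring_nf

/-! ### The stopping probabilities of a group sequential trial -/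

/-- The conditional probability of stopping at stage `i`, given that it is reached. -/
noncomputable def stageProb {Ω : Type*} (X : ℕ → Ω → ℝ) (ψ : ℝ → ℝ) (γ : ℝ) {L : ℕ} (k : Fin (L + 1) → ℕ)
    (n : ℕ) (ω : Ω) (i : Fin (L + 1)) : ℝ :=
  if i = Fin.last L then 1 else ψ (partialSum X (k i * n) ω / ((k i : ℝ) * n) ^ γ)

lemma measurable_stageProb {Ω : Type*} [MeasurableSpace Ω] {X : ℕ → Ω → ℝ}
    (hX : ∀ j, Measurable (X j)) {ψ : ℝ → ℝ} (hψ : Measurable ψ) (γ : ℝ) {L : ℕ}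
    (k : Fin (L + 1) → ℕ) (n : ℕ) (i : Fin (L + 1)) :
    Measurable fun ω => stageProb X ψ γ k n ω i := by
  unfold stageProb
  split_ifs
  · exact measurable_const
  · exact hψ.comp ((measurable_partialSum hX _).div_const _)

lemma stageProb_mem_Icc {Ω : Type*} {X : ℕ → Ω → ℝ} {ψ : ℝ → ℝ}
    (hψ : ∀ x, ψ x ∈ Set.Icc (0 : ℝ) 1) (γ : ℝ) {L : ℕ} (k : Fin (L + 1) → ℕ) (n : ℕ) (ω : Ω)
    (i : Fin (L + 1)) : stageProb X ψ γ k n ω i ∈ Set.Icc (0 : ℝ) 1 := by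
  unfold stageProb
  split_ifs
  · simp
  · exact hψ _

lemma stopWeight_stageProb_castSucc {Ω : Type*} (X : ℕ → Ω → ℝ) (ψ : ℝ → ℝ) (γ : ℝ) {L : ℕ}
    (k : Fin (L + 1) → ℕ) (n : ℕ) (ω : Ω) (i : Fin L) :
    stopWeight (stageProb X ψ γ k n ω) i.castSucc =
      ψ (partialSum X (k i.castSucc * n) ω / ((k i.castSucc : ℝ) * n) ^ γ) *
          ∏ j ∈ Finset.Iio i.castSucc,
            (1 - ψ (partialSum X (k j * n) ω / ((k j : ℝ) * n) ^ γ)) := by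
  rw [stopWeight, stageProb, if_neg i.castSucc_lt_last.ne]
  congr 1
  refine Finset.prod_congr rfl fun j hj => ?_
  rw [stageProb, if_neg ((Finset.mem_Iio.1 hj).trans i.castSucc_lt_last).ne]

namespace IsGroupSequentialSize

variable {Ω : Type*} [MeasurableSpace Ω] {P : Measure Ω} [IsProbabilityMeasure P]
  {X : ℕ → Ω → ℝ} {ψ : ℝ → ℝ} {γ : ℝ} {L : ℕ} {k : Fin (L + 1) → ℕ} {n : ℕ} {N : Ω → ℕ}

lemma integrable_stopWeight (hX : ∀ j, Measurable (X j)) (hψmeas : Measurable ψ)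
    (hψ : ∀ x, ψ x ∈ Set.Icc (0 : ℝ) 1) (i : Fin (L + 1)) :
    Integrable (fun ω => stopWeight (stageProb X ψ γ k n ω) i) P :=
  Integrable.of_bound
    (measurable_stopWeight (measurable_stageProb hX hψmeas γ k n) i).aestronglyMeasurable 1
    (ae_of_all _ fun ω => abs_stopWeight_le_one (stageProb_mem_Icc hψ γ k n ω) i)

/-- Allowing `B` to depend on later observations is what nonanticipation provides; the final stage
needs this, since its event involves data beyond the interim analyses. -/
lemma measureReal_inter_castSucc (h : IsGroupSequentialSize P X ψ γ k n N)
    (hX : ∀ j, Measurable (X j)) (i : Fin L) {B : Set Ω} (hB : MeasurableSet[sigmaAll X] B) :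
    P.real ({ω | N ω = k i.castSucc * n} ∩ B) =
      ∫ ω in B, stopWeight (stageProb X ψ γ k n ω) i.castSucc ∂P := by
  have hm : sigmaAll X ≤ ‹MeasurableSpace Ω› := (measurable_pi_lambda _ hX).comap_le
  have hS : MeasurableSet {ω | N ω = k i.castSucc * n} := h.measurable (measurableSet_singleton _)
  have hae : condProbEvent P {ω | N ω = k i.castSucc * n} (sigmaAll X) =ᵐ[P]
      fun ω => stopWeight (stageProb X ψ γ k n ω) i.castSucc := by
    simp only [stopWeight_stageProb_castSucc]
    exact (h.nonanticipating i).trans (h.stopping_rule i)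
  rw [← integral_congr_ae (ae_restrict_of_ae hae), condProbEvent,
    setIntegral_condExp hm ((integrable_const (1 : ℝ)).indicator hS) hB,
    integral_indicator_const _ hS, measureReal_restrict_apply hS, smul_eq_mul, mul_one]

lemma sum_measureReal_inter (h : IsGroupSequentialSize P X ψ γ k n N) (hk : StrictMono k)
    (hn : 0 < n) {B : Fin (L + 1) → Set Ω} (hB : ∀ i, MeasurableSet (B i)) {C : Set Ω}
    (hC : ∀ i, {ω | N ω = k i * n} ∩ C = {ω | N ω = k i * n} ∩ B i) :
    P.real C = ∑ i, P.real ({ω | N ω = k i * n} ∩ B i) := by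
  rw [← measureReal_biUnion_finset]
  · congr 1
    ext ω
    simp only [← hC, Finset.mem_univ, Set.iUnion_true, Set.mem_iUnion, Set.mem_inter_iff,
      Set.mem_ofPred_eq, exists_and_right]
    exact ⟨fun hω => ⟨h.mem_range ω, hω⟩, fun hω => hω.2⟩
  · intro i _ j _ hij
    refine Set.disjoint_left.2 fun ω h1 h2 => hij (hk.injective ?_)
    have h1' : N ω = k i * n := h1.1
    have h2' : N ω = k j * n := h2.1
    exact Nat.eq_of_mul_eq_mul_right hn (h1'.symm.trans h2')
  · exact fun i _ => (h.measurable (measurableSet_singleton _)).inter (hB i)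

/-- No rule is postulated at the final stage: its formula follows by subtracting the interim ones
from `P.real B`, as the weights sum to one. -/
lemma measureReal_inter (h : IsGroupSequentialSize P X ψ γ k n N)
    (hX : ∀ j, Measurable (X j)) (hk : StrictMono k) (hn : 0 < n) (hψmeas : Measurable ψ)
    (hψ : ∀ x, ψ x ∈ Set.Icc (0 : ℝ) 1) (i : Fin (L + 1)) {B : Set Ω}
    (hB : MeasurableSet[sigmaAll X] B) :
    P.real ({ω | N ω = k i * n} ∩ B) = ∫ ω in B, stopWeight (stageProb X ψ γ k n ω) i ∂P := by
  induction i using Fin.lastCases with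
  | cast i => exact h.measureReal_inter_castSucc hX i hB
  | last =>
    have hm : sigmaAll X ≤ ‹MeasurableSpace Ω› := (measurable_pi_lambda _ hX).comap_le
    have h1 := h.sum_measureReal_inter hk hn (B := fun _ => B) (fun _ => hm _ hB)
      (C := B) (fun _ => rfl)
    have h2 : ∑ i, ∫ ω in B, stopWeight (stageProb X ψ γ k n ω) i ∂P = P.real B := by
      rw [← integral_finsetSum _ fun i _ => (integrable_stopWeight hX hψmeas hψ i).restrict,
        setIntegral_congr_fun (g := fun _ => (1 : ℝ)) (hm _ hB)
          (fun ω _ => sum_stopWeight (by simp [stageProb]))]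
      simp
    rw [Fin.sum_univ_castSucc] at h1 h2
    rw [Finset.sum_congr rfl fun i _ => h.measureReal_inter_castSucc hX i hB] at h1
    linarith

/-- The distance of the studentised mean from normality is at most the sum of the distances in mean
of the stopping weights from constants. -/
lemma abs_measureReal_preimage_sub_le (h : IsGroupSequentialSize P X ψ γ k n N)
    (hX : ∀ j, Measurable (X j)) (hindep : iIndepFun X P) {μ σ : ℝ} (hσ : 0 < σ)
    (hlaw : ∀ j, P.map (X j) = gaussianReal μ ⟨σ ^ 2, sq_nonneg σ⟩)
    (hk0 : 0 < k 0) (hk : StrictMono k) (hn : 0 < n) (hψmeas : Measurable ψ)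
    (hψ : ∀ x, ψ x ∈ Set.Icc (0 : ℝ) 1) {c : Fin (L + 1) → ℝ} (hc : c (Fin.last L) = 1)
    {A : Set ℝ} (hA : MeasurableSet A) :
    |(gaussianReal 0 1).real A -
        P.real ((fun ω => √(N ω : ℝ) / σ * (sampleMean X N ω - μ)) ⁻¹' A)| ≤
      ∑ i, ∫ ω, |stopWeight (stageProb X ψ γ k n ω) i - stopWeight c i| ∂P := by
  have hm : sigmaAll X ≤ ‹MeasurableSpace Ω› := (measurable_pi_lambda _ hX).comap_le
  have hkpos : ∀ i, 0 < k i * n := fun i =>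
    Nat.mul_pos (hk0.trans_le (hk.monotone (Fin.zero_le i))) hn
  set B : Fin (L + 1) → Set Ω := fun i => standardizedSum X μ σ (k i * n) ⁻¹' A with hBdef
  have hB : ∀ i, MeasurableSet[sigmaAll X] (B i) := fun i =>
    (((measurable_sigmaAll_partialSum X (k i * n)).sub_const _).div_const _) hA
  have hBm : ∀ i, MeasurableSet (B i) := fun i => hm _ (hB i)
  have hBlaw : ∀ i, P.real (B i) = (gaussianReal 0 1).real A := fun i => by
    rw [← map_standardizedSum hσ hX hindep hlaw (hkpos i), map_measureReal_apply _ hA]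
    exact ((measurable_partialSum hX _).sub_const _).div_const _
  have hw := fun i => integrable_stopWeight (P := P) (γ := γ) (k := k) (n := n) hX hψmeas hψ i
  have hsum := h.sum_measureReal_inter hk hn hBm
    (C := (fun ω => √(N ω : ℝ) / σ * (sampleMean X N ω - μ)) ⁻¹' A) fun i => by
      ext ω
      simp only [Set.mem_inter_iff, Set.mem_ofPred_eq, Set.mem_preimage, hBdef]
      refine and_congr_right fun hω => ?_
      rw [sqrt_div_mul_sampleMean_sub hσ (hω ▸ hkpos i), hω]
  -- The ideal mixture: all `B i` have the same Gaussian mass and the constant weights sum to one.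
  have hconst : (gaussianReal 0 1).real A = ∑ i, ∫ ω in B i, stopWeight c i ∂P := by
    simp only [integral_const, measureReal_restrict_apply_univ, hBlaw, smul_eq_mul]
    rw [← Finset.mul_sum, sum_stopWeight hc, mul_one]
  rw [abs_sub_comm, hsum, hconst, ← Finset.sum_sub_distrib]
  refine (Finset.abs_sum_le_sum_abs _ _).trans (Finset.sum_le_sum fun i _ => ?_)
  have hint : Integrable (fun ω => stopWeight (stageProb X ψ γ k n ω) i - stopWeight c i) P :=
    (hw i).sub (integrable_const _)
  rw [h.measureReal_inter hX hk hn hψmeas hψ i (hB i),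
    ← integral_sub (hw i).restrict (integrable_const _)]
  exact abs_integral_le_integral_abs.trans
    (setIntegral_le_integral hint.abs (ae_of_all _ fun ω => abs_nonneg _))

end IsGroupSequentialSize

/-! ### Limits of the normalised sums -/

/-- The value of `K_m / m ^ γ` when the standardised sum has the value `x`. -/
noncomputable def scaledSum (μ σ γ : ℝ) (x : ℝ) (m : ℕ) : ℝ := (m * μ + σ * √m * x) / (m : ℝ) ^ γ

lemma scaledSum_eq (μ σ γ x : ℝ) {m : ℕ} (hm : 0 < m) :
    scaledSum μ σ γ x m = (m : ℝ) ^ (1 - γ) * μ + (m : ℝ) ^ (1 / 2 - γ) * (σ * x) := by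
  have hm' : (0 : ℝ) < m := by exact_mod_cast hm
  rw [scaledSum, Real.rpow_sub hm', Real.rpow_sub hm', Real.rpow_one, Real.sqrt_eq_rpow]
  ring

lemma scaledSum_eventuallyEq (μ σ γ x : ℝ) :
    (fun m : ℕ => (m : ℝ) ^ (1 - γ) * μ + (m : ℝ) ^ (1 / 2 - γ) * (σ * x)) =ᶠ[atTop]
      scaledSum μ σ γ x := by
  filter_upwards [eventually_gt_atTop 0] with m hm using (scaledSum_eq μ σ γ x hm).symm

lemma tendsto_natCast_rpow_of_neg {y : ℝ} (hy : y < 0) :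
    Tendsto (fun m : ℕ => (m : ℝ) ^ y) atTop (𝓝 0) := by
  have h := (tendsto_rpow_neg_atTop (neg_pos.2 hy)).comp tendsto_natCast_atTop_atTop
  simpa [Function.comp_def] using h

lemma tendsto_natCast_rpow_of_pos {y : ℝ} (hy : 0 < y) :
    Tendsto (fun m : ℕ => (m : ℝ) ^ y) atTop atTop :=
  (tendsto_rpow_atTop hy).comp tendsto_natCast_atTop_atTop

lemma ae_gaussianReal_ne (c : ℝ) : ∀ᵐ x ∂gaussianReal 0 1, x ≠ c := by
  have : NullSingletonClass (gaussianReal 0 1) := nullSingletonClass_gaussianReal one_ne_zero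
  exact Measure.ae_ne _ c

/-- Each `m > 0` admits only one `x` at which the sequence equals `c`; discarding these countably
many points lets a punctured limit of `ψ` suffice. -/
lemma ae_tendsto_scaledSum_nhdsNE {μ σ γ c : ℝ} (hσ : 0 < σ)
    (h : ∀ x, Tendsto (scaledSum μ σ γ x) atTop (𝓝 c)) :
    ∀ᵐ x ∂gaussianReal 0 1, Tendsto (scaledSum μ σ γ x) atTop (𝓝[≠] c) := by
  have hne : ∀ᵐ x ∂gaussianReal 0 1, ∀ m : ℕ, x ≠ (c * (m : ℝ) ^ γ - m * μ) / (σ * √m) :=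
    ae_all_iff.2 fun m => ae_gaussianReal_ne _
  filter_upwards [hne] with x hx
  refine tendsto_nhdsWithin_iff.2 ⟨h x, ?_⟩
  filter_upwards [eventually_gt_atTop 0] with m hm heq
  have hm' : (0 : ℝ) < m := by exact_mod_cast hm
  have h1 : (0 : ℝ) < (m : ℝ) ^ γ := Real.rpow_pos_of_pos hm' γ
  have h2 : (0 : ℝ) < √m := Real.sqrt_pos.2 hm'
  rw [Set.mem_singleton_iff, scaledSum, div_eq_iff h1.ne'] at heq
  refine hx m ?_
  rw [← heq]
  field_simp
  ring

lemma tendsto_scaledSum_of_one_lt {μ σ γ : ℝ} (hγ : 1 < γ) (x : ℝ) :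
    Tendsto (scaledSum μ σ γ x) atTop (𝓝 0) := by
  refine Tendsto.congr' (scaledSum_eventuallyEq μ σ γ x) ?_
  simpa using ((tendsto_natCast_rpow_of_neg (y := 1 - γ) (by linarith)).mul_const μ).add
    ((tendsto_natCast_rpow_of_neg (y := 1 / 2 - γ) (by linarith)).mul_const (σ * x))

lemma tendsto_scaledSum_one (μ σ x : ℝ) : Tendsto (scaledSum μ σ 1 x) atTop (𝓝 μ) := by
  refine Tendsto.congr' (scaledSum_eventuallyEq μ σ 1 x) ?_
  simpa only [sub_self, Real.rpow_zero, one_mul, zero_mul, add_zero] using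
    (tendsto_const_nhds (x := μ)).add
      ((tendsto_natCast_rpow_of_neg (y := 1 / 2 - 1) (by norm_num)).mul_const (σ * x))

lemma tendsto_scaledSum_zero_of_half_lt {σ γ : ℝ} (hγ : 1 / 2 < γ) (x : ℝ) :
    Tendsto (scaledSum 0 σ γ x) atTop (𝓝 0) := by
  refine Tendsto.congr' (scaledSum_eventuallyEq 0 σ γ x) ?_
  simpa using (tendsto_natCast_rpow_of_neg (y := 1 / 2 - γ) (by linarith)).mul_const (σ * x)

lemma tendsto_drift_add (μ σ x : ℝ) :
    Tendsto (fun m : ℕ => μ + (m : ℝ) ^ (-(1 / 2) : ℝ) * (σ * x)) atTop (𝓝 μ) := by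
  simpa only [zero_mul, add_zero] using (tendsto_const_nhds (x := μ)).add
    ((tendsto_natCast_rpow_of_neg (y := -(1 / 2)) (by norm_num)).mul_const (σ * x))

/-- Factoring out `m ^ (1 - γ)` shows the drift beating the fluctuations for every `γ < 1`, which
treats (C)(1), (D) and (E)(1) together. -/
lemma scaledSum_eventuallyEq_mul (μ σ γ x : ℝ) :
    (fun m : ℕ => (m : ℝ) ^ (1 - γ) * (μ + (m : ℝ) ^ (-(1 / 2) : ℝ) * (σ * x))) =ᶠ[atTop]
      scaledSum μ σ γ x := by
  filter_upwards [eventually_gt_atTop 0] with m hm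
  have hm' : (0 : ℝ) < m := by exact_mod_cast hm
  rw [scaledSum_eq μ σ γ x hm, mul_add, ← mul_assoc, ← Real.rpow_add hm']
  ring_nf

lemma tendsto_scaledSum_atTop {μ σ γ : ℝ} (hγ : γ < 1) (hμ : 0 < μ) (x : ℝ) :
    Tendsto (scaledSum μ σ γ x) atTop atTop :=
  Tendsto.congr' (scaledSum_eventuallyEq_mul μ σ γ x)
    ((tendsto_natCast_rpow_of_pos (sub_pos.2 hγ)).atTop_mul_pos hμ (tendsto_drift_add μ σ x))

lemma tendsto_scaledSum_atBot {μ σ γ : ℝ} (hγ : γ < 1) (hμ : μ < 0) (x : ℝ) :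
    Tendsto (scaledSum μ σ γ x) atTop atBot :=
  Tendsto.congr' (scaledSum_eventuallyEq_mul μ σ γ x)
    ((tendsto_natCast_rpow_of_pos (sub_pos.2 hγ)).atTop_mul_neg hμ (tendsto_drift_add μ σ x))

/-- Without drift the sign of `x` decides between the two infinities, whence the coinciding limits
required of `ψ` in (E)(2). -/
lemma ae_tendsto_scaledSum_zero_atBot_sup_atTop {σ γ : ℝ} (hσ : 0 < σ) (hγ : γ < 1 / 2) :
    ∀ᵐ x ∂gaussianReal 0 1, Tendsto (scaledSum 0 σ γ x) atTop (atBot ⊔ atTop) := by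
  filter_upwards [ae_gaussianReal_ne 0] with x hx
  refine Tendsto.congr' (scaledSum_eventuallyEq 0 σ γ x) ?_
  simp only [mul_zero, zero_add]
  have h := tendsto_natCast_rpow_of_pos (sub_pos.2 hγ)
  rcases hx.lt_or_gt with hx | hx
  · exact (h.atTop_mul_const_of_neg (mul_neg_of_pos_of_neg hσ hx)).mono_right le_sup_left
  · exact (h.atTop_mul_const (mul_pos hσ hx)).mono_right le_sup_right

lemma exists_ae_tendsto_comp_scaledSum_of_ne_zero {μ σ γ : ℝ} {ψ : ℝ → ℝ} (hγ : γ < 1)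
    (hμ : μ ≠ 0) (hbot : ∃ l : ℝ, Tendsto ψ atBot (𝓝 l)) (htop : ∃ l : ℝ, Tendsto ψ atTop (𝓝 l)) :
    ∃ l : ℝ, ∀ᵐ x ∂gaussianReal 0 1,
      Tendsto (fun m => ψ (scaledSum μ σ γ x m)) atTop (𝓝 l) := by
  rcases hμ.lt_or_gt with hμ | hμ
  · obtain ⟨l, hl⟩ := hbot
    exact ⟨l, ae_of_all _ fun x => hl.comp (tendsto_scaledSum_atBot hγ hμ x)⟩
  · obtain ⟨l, hl⟩ := htop
    exact ⟨l, ae_of_all _ fun x => hl.comp (tendsto_scaledSum_atTop hγ hμ x)⟩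

lemma tendsto_integral_abs_comp_partialSum_sub {Ω : Type*} [MeasurableSpace Ω] {P : Measure Ω}
    [IsProbabilityMeasure P] {μ σ : ℝ} (hσ : 0 < σ) {X : ℕ → Ω → ℝ}
    (hX : ∀ j, Measurable (X j)) (hindep : iIndepFun X P)
    (hlaw : ∀ j, P.map (X j) = gaussianReal μ ⟨σ ^ 2, sq_nonneg σ⟩) {ψ : ℝ → ℝ}
    (hψmeas : Measurable ψ) (hψ : ∀ x, ψ x ∈ Set.Icc (0 : ℝ) 1) {γ l : ℝ}
    (h : ∀ᵐ x ∂gaussianReal 0 1, Tendsto (fun m => ψ (scaledSum μ σ γ x m)) atTop (𝓝 l)) :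
    Tendsto (fun m : ℕ => ∫ ω, |ψ (partialSum X m ω / (m : ℝ) ^ γ) - l| ∂P) atTop (𝓝 0) := by
  have hmeas : ∀ m, Measurable fun x => |ψ (scaledSum μ σ γ x m) - l| := fun m => by
    refine Measurable.abs (Measurable.sub_const (hψmeas.comp ?_) l)
    unfold scaledSum
    fun_prop
  have hlim : Tendsto (fun m => ∫ x, |ψ (scaledSum μ σ γ x m) - l| ∂gaussianReal 0 1) atTop
      (𝓝 (∫ _, 0 ∂gaussianReal 0 1)) := by
    refine tendsto_integral_of_dominated_convergence (fun _ => 1 + |l|)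
      (fun m => (hmeas m).aestronglyMeasurable) (integrable_const _)
      (fun m => ae_of_all _ fun x => ?_) ?_
    · rw [Real.norm_eq_abs, abs_abs]
      refine (abs_sub _ _).trans ?_
      gcongr
      exact abs_le.2 ⟨by linarith [(hψ (scaledSum μ σ γ x m)).1], (hψ _).2⟩
    · filter_upwards [h] with x hx
      simpa using (hx.sub_const l).abs
  rw [integral_zero] at hlim
  refine hlim.congr' ?_
  filter_upwards [eventually_gt_atTop 0] with m hm
  have hZ : Measurable (standardizedSum X μ σ m) :=
    ((measurable_partialSum hX _).sub_const _).div_const _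
  rw [← map_standardizedSum hσ hX hindep hlaw hm,
    integral_map hZ.aemeasurable (hmeas m).aestronglyMeasurable]
  refine integral_congr_ae (ae_of_all _ fun ω => ?_)
  simp only [scaledSum, ← partialSum_eq hσ hm ω]

lemma tendsto_integral_abs_stageProb_sub {Ω : Type*} [MeasurableSpace Ω] {P : Measure Ω}
    {X : ℕ → Ω → ℝ} {ψ : ℝ → ℝ} {γ l : ℝ}
    (h : Tendsto (fun m : ℕ => ∫ ω, |ψ (partialSum X m ω / (m : ℝ) ^ γ) - l| ∂P) atTop (𝓝 0))
    {L : ℕ} {k : Fin (L + 1) → ℕ} (hk0 : 0 < k 0) (hk : StrictMono k) (i : Fin (L + 1)) :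
    Tendsto (fun n => ∫ ω, |stageProb X ψ γ k n ω i - if i = Fin.last L then 1 else l| ∂P)
      atTop (𝓝 0) := by
  unfold stageProb
  split_ifs with hi
  · simp
  · have hki : 0 < k i := hk0.trans_le (hk.monotone (Fin.zero_le i))
    -- Pass to the subsequence `m = k i * n`.
    simpa [Function.comp_def] using
      h.comp (tendsto_id.const_mul_atTop' hki)

/-! ### Total variation distance and confidence intervals -/

lemma abs_measureReal_sub_le_tvDist {Ω Ω' : Type*} [MeasurableSpace Ω] [MeasurableSpace Ω']
    (P : Measure Ω) [IsProbabilityMeasure P] (Y : Ω → ℝ) (Q : Measure Ω')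
    [IsProbabilityMeasure Q] (Z : Ω' → ℝ) {A : Set ℝ} (hA : MeasurableSet A) :
    |P.real (Y ⁻¹' A) - Q.real (Z ⁻¹' A)| ≤ tvDist P Y Q Z := by
  refine le_ciSup (f := fun A : {A : Set ℝ // MeasurableSet A} =>
    |P.real (Y ⁻¹' A.1) - Q.real (Z ⁻¹' A.1)|) ⟨1, ?_⟩ ⟨A, hA⟩
  rintro _ ⟨B, rfl⟩
  refine abs_le.2 ⟨?_, ?_⟩ <;>
  linarith [measureReal_nonneg (μ := P) (s := Y ⁻¹' B.1), measureReal_le_one (μ := P)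
    (s := Y ⁻¹' B.1), measureReal_nonneg (μ := Q) (s := Z ⁻¹' B.1), measureReal_le_one (μ := Q)
    (s := Z ⁻¹' B.1)]

/-- Uses symmetry of the normal law and its lack of atoms. -/
lemma gaussianReal_real_Icc_neg {x : ℝ} (hx : 0 ≤ x) :
    (gaussianReal 0 1).real (Set.Icc (-x) x) = 2 * cdf (gaussianReal 0 1) x - 1 := by
  have : NullSingletonClass (gaussianReal 0 1) := nullSingletonClass_gaussianReal one_ne_zero
  have hsymm : (gaussianReal 0 1).real (Set.Iic (-x)) = (gaussianReal 0 1).real (Set.Ici x) := by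
    conv_lhs => rw [← neg_zero, ← gaussianReal_map_neg]
    rw [map_measureReal_apply measurable_neg measurableSet_Iic]
    congr 1
    ext y
    simp
  have hIoc : (gaussianReal 0 1).real (Set.Icc (-x) x) = (gaussianReal 0 1).real (Set.Ioc (-x) x) :=
    measureReal_congr Ioc_ae_eq_Icc.symm
  have hIci : (gaussianReal 0 1).real (Set.Ici x) = (gaussianReal 0 1).real (Set.Ioi x) :=
    measureReal_congr Ioi_ae_eq_Ici.symm
  have hcompl := probReal_compl_eq_one_sub (μ := gaussianReal 0 1) (measurableSet_Iic (a := x))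
  rw [Set.compl_Iic] at hcompl
  have hdiff := measureReal_sdiff (μ := gaussianReal 0 1)
    (Set.Iic_subset_Iic.2 (by linarith : -x ≤ x)) measurableSet_Iic
  rw [Set.Iic_sdiff_Iic] at hdiff
  rw [hIoc, hdiff, hsymm, hIci, hcompl, cdf_eq_real]
  ring

lemma setOf_mem_confidenceInterval_eq {Ω : Type*} (Y : Ω → ℝ) {N : Ω → ℕ} (hN : ∀ ω, 0 < N ω)
    {σ : ℝ} (hσ : 0 < σ) (μ x : ℝ) :
    {ω | Y ω - σ / √(N ω : ℝ) * x ≤ μ ∧ μ ≤ Y ω + σ / √(N ω : ℝ) * x} =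
      (fun ω => √(N ω : ℝ) / σ * (Y ω - μ)) ⁻¹' Set.Icc (-x) x := by
  ext ω
  have h1 : (0 : ℝ) < √(N ω : ℝ) := Real.sqrt_pos.2 (by exact_mod_cast hN ω)
  have ha : 0 < √(N ω : ℝ) / σ := by positivity
  have hinv : σ / √(N ω : ℝ) = (√(N ω : ℝ) / σ)⁻¹ := (inv_div _ _).symm
  simp only [Set.mem_ofPred_eq, Set.mem_preimage, Set.mem_Icc, hinv]
  generalize √(N ω : ℝ) / σ = a at ha
  have h2 : a * (a⁻¹ * x) = x := by field_simp
  rw [and_comm, ← abs_le, ← sub_le_iff_le_add, ← mul_le_mul_iff_right₀ ha]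
  constructor
  · rintro ⟨h3, h4⟩
    have h5 := mul_le_mul_of_nonneg_left h4 ha.le
    exact abs_le.2 ⟨by linarith, by linarith⟩
  · intro h3
    obtain ⟨h4, h5⟩ := abs_le.1 h3
    refine ⟨by linarith, le_of_mul_le_mul_left ?_ ha⟩
    linarith

theorem theorem6 {Ω Ω' : Type*} [MeasurableSpace Ω] [MeasurableSpace Ω']
    (P : Measure Ω) [IsProbabilityMeasure P]
    (μ σ : ℝ) (hσ : 0 < σ)
    (X : ℕ → Ω → ℝ) (hXmeas : ∀ j, Measurable (X j)) (hXindep : iIndepFun X P)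
    (hXlaw : ∀ j, P.map (X j) = gaussianReal μ ⟨σ ^ 2, sq_nonneg σ⟩)
    (L : ℕ) (hL : 1 ≤ L)
    (k : Fin (L + 1) → ℕ) (hk0 : 0 < k 0) (hk : StrictMono k)
    (ψ : ℝ → ℝ) (hψmeas : Measurable ψ) (hψ : ∀ x, ψ x ∈ Set.Icc (0 : ℝ) 1)
    (γ : ℝ) (hγ : 0 ≤ γ)
    (N : ℕ → Ω → ℕ) (hN : ∀ n, 1 ≤ n → IsGroupSequentialSize P X ψ γ k n (N n))
    (Q : Measure Ω') [IsProbabilityMeasure Q]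
    (ξ : Ω' → ℝ) (hξmeas : Measurable ξ) (hξlaw : Q.map ξ = gaussianReal 0 1)
    (hcase :
      -- (A)
      (1 < γ ∧ ∃ l : ℝ, Tendsto ψ (𝓝[≠] 0) (𝓝 l)) ∨
      -- (B)
      (γ = 1 ∧ ∃ l : ℝ, Tendsto ψ (𝓝[≠] μ) (𝓝 l)) ∨
      -- (C) (1)
      (1 / 2 < γ ∧ γ < 1 ∧ μ ≠ 0 ∧
        (∃ l : ℝ, Tendsto ψ atBot (𝓝 l)) ∧ ∃ l : ℝ, Tendsto ψ atTop (𝓝 l)) ∨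
      -- (C) (2)
      (1 / 2 < γ ∧ γ < 1 ∧ μ = 0 ∧ ∃ l : ℝ, Tendsto ψ (𝓝[≠] 0) (𝓝 l)) ∨
      -- (D)
      (γ = 1 / 2 ∧ μ ≠ 0 ∧
        (∃ l : ℝ, Tendsto ψ atBot (𝓝 l)) ∧ ∃ l : ℝ, Tendsto ψ atTop (𝓝 l)) ∨
      -- (E) (1)
      (0 ≤ γ ∧ γ < 1 / 2 ∧ μ ≠ 0 ∧
        (∃ l : ℝ, Tendsto ψ atBot (𝓝 l)) ∧ ∃ l : ℝ, Tendsto ψ atTop (𝓝 l)) ∨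
      -- (E) (2)
      (0 ≤ γ ∧ γ < 1 / 2 ∧ μ = 0 ∧
        ∃ l : ℝ, Tendsto ψ atBot (𝓝 l) ∧ Tendsto ψ atTop (𝓝 l))) :
    Tendsto
      (fun n : ℕ =>
        tvDist Q ξ P (fun ω => √(N n ω : ℝ) / σ * (sampleMean X (N n) ω - μ)))
      atTop (𝓝 0) ∧
    ∀ x : ℝ, 0 < x →
      Tendsto
        (fun n : ℕ =>
          |2 * cdf (gaussianReal 0 1) x - 1 -
            P.real {ω | sampleMean X (N n) ω - σ / √(N n ω : ℝ) * x ≤ μ ∧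
              μ ≤ sampleMean X (N n) ω + σ / √(N n ω : ℝ) * x}|)
        atTop (𝓝 0) := by
  obtain ⟨l, hl⟩ : ∃ l : ℝ, ∀ᵐ x ∂gaussianReal 0 1,
      Tendsto (fun m => ψ (scaledSum μ σ γ x m)) atTop (𝓝 l) := by
    rcases hcase with ⟨h, l, hl⟩ | ⟨rfl, l, hl⟩ | ⟨-, h, hμ, hbot, htop⟩ | ⟨h, -, rfl, l, hl⟩ |
      ⟨rfl, hμ, hbot, htop⟩ | ⟨-, h, hμ, hbot, htop⟩ | ⟨-, h, rfl, l, hbot, htop⟩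
    · exact ⟨l, (ae_tendsto_scaledSum_nhdsNE hσ (tendsto_scaledSum_of_one_lt h)).mono
        fun x hx => hl.comp hx⟩
    · exact ⟨l, (ae_tendsto_scaledSum_nhdsNE hσ (tendsto_scaledSum_one μ σ)).mono
        fun x hx => hl.comp hx⟩
    · exact exists_ae_tendsto_comp_scaledSum_of_ne_zero h hμ hbot htop
    · exact ⟨l, (ae_tendsto_scaledSum_nhdsNE hσ (tendsto_scaledSum_zero_of_half_lt h)).mono
        fun x hx => hl.comp hx⟩
    · exact exists_ae_tendsto_comp_scaledSum_of_ne_zero (by norm_num) hμ hbot htop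
    · exact exists_ae_tendsto_comp_scaledSum_of_ne_zero (by linarith) hμ hbot htop
    · exact ⟨l, (ae_tendsto_scaledSum_zero_atBot_sup_atTop hσ h).mono
        fun x hx => (hbot.sup htop).comp hx⟩
  -- The limiting stage probabilities: `l` at each interim analysis, certain stopping at the end.
  set c : Fin (L + 1) → ℝ := fun i => if i = Fin.last L then 1 else l
  have hweights : Tendsto
      (fun n => ∑ i, ∫ ω, |stopWeight (stageProb X ψ γ k n ω) i - stopWeight c i| ∂P)
      atTop (𝓝 0) := by
    rw [← Finset.sum_const_zero (s := (Finset.univ : Finset (Fin (L + 1))))]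
    exact tendsto_finsetSum _ fun i _ => tendsto_integral_abs_stopWeight_sub
      (r := fun i n ω => stageProb X ψ γ k n ω i)
      (fun i n => measurable_stageProb hXmeas hψmeas γ k n i)
      (fun i n ω => stageProb_mem_Icc hψ γ k n ω i)
      (tendsto_integral_abs_stageProb_sub (tendsto_integral_abs_comp_partialSum_sub hσ hXmeas
        hXindep hXlaw hψmeas hψ hl) hk0 hk) i
  have hξ : ∀ {A : Set ℝ}, MeasurableSet A → Q.real (ξ ⁻¹' A) = (gaussianReal 0 1).real A :=
    fun hA => by rw [← hξlaw, map_measureReal_apply hξmeas hA]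
  have htv : Tendsto
      (fun n : ℕ => tvDist Q ξ P (fun ω => √(N n ω : ℝ) / σ * (sampleMean X (N n) ω - μ)))
      atTop (𝓝 0) := by
    refine squeeze_zero' (Eventually.of_forall fun n =>
      Real.iSup_nonneg fun _ => abs_nonneg _) ?_ hweights
    -- Nothing is assumed about `N 0`, so the bound is only eventual.
    filter_upwards [eventually_ge_atTop 1] with n hn
    refine Real.iSup_le (fun A => ?_)
      (Finset.sum_nonneg fun i _ => integral_nonneg fun ω => abs_nonneg _)
    rw [hξ A.2]
    exact (hN n hn).abs_measureReal_preimage_sub_le hXmeas hXindep hσ hXlaw hk0 hk hn hψmeas hψ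
      (by simp [c]) A.2
  refine ⟨htv, fun x hx => squeeze_zero' (Eventually.of_forall fun n => abs_nonneg _) ?_ htv⟩
  filter_upwards [eventually_ge_atTop 1] with n hn
  have hNpos : ∀ ω, 0 < N n ω := fun ω => by
    obtain ⟨i, hi⟩ := (hN n hn).mem_range ω
    rw [hi]
    exact Nat.mul_pos (hk0.trans_le (hk.monotone (Fin.zero_le i))) hn
  -- Coverage is the event that the studentised mean lies in `[-x, x]`, one of the sets in the
  -- supremum.
  rw [← gaussianReal_real_Icc_neg hx.le, ← hξ measurableSet_Icc,
    setOf_mem_confidenceInterval_eq (sampleMean X (N n)) hNpos hσ μ x]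
  exact abs_measureReal_sub_le_tvDist Q ξ P _ measurableSet_Icc
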